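/- For an integer $n>0$, say that a group $G$ satisfies the condition $(\mathcal{N},n)$ if every subset of $G$ with exactly $n+1$ elements contains two distinct elements $x,y$ such that the subgroup $\langle x,y\rangle$ is nilpotent. A group $G$ is supersoluble if it has a finite series $1=N_0\le N_1\le\dots\le N_r=G$ of normal subgroups of $G$ such that every factor $N_{i+1}/N_i$ is cyclic. Every finite group satisfying the condition $(\mathcal{N},4)$ is supersoluble. Moreover, the alternating group $A_4$ of degree $4$ satisfies the condition $(\mathcal{N},5)$. -/

import Mathlib

/-- The condition `(𝒳, n)` on a group `G`, for a class of groups `𝒳`: every subset of `G` with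
exactly `n + 1` elements contains two distinct elements `x`, `y` such that the subgroup `⟨x, y⟩`
belongs to `𝒳`. -/
def SatisfiesPairCondition.{u} (𝒳 : (H : Type u) → [Group H] → Prop) (n : ℕ)
    (G : Type u) [Group G] : Prop :=
  ∀ S : Finset G, S.card = n + 1 →
    ∃ x ∈ S, ∃ y ∈ S, x ≠ y ∧ 𝒳 (Subgroup.closure ({x, y} : Set G))

/-- The class `𝒩` of nilpotent groups. -/
def NilpotentClass.{u} (H : Type u) [Group H] : Prop := Group.IsNilpotent H

/-- A group `G` is supersoluble if it has a finite series `1 = N₀ ≤ N₁ ≤ ⋯ ≤ N_r = G` of normal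
subgroups of `G` all of whose factors `N_{i+1} / N_i` are cyclic. The factor is
taken as a subgroup of `G / N_i`, namely the image of `N_{i+1}`; the terms with index above `r`
play no role. -/
def IsSupersoluble.{u} (G : Type u) [Group G] : Prop :=
  ∃ (r : ℕ) (N : ℕ → Subgroup G) (_ : ∀ i, (N i).Normal),
    N 0 = ⊥ ∧ N r = ⊤ ∧
      ∀ i < r, N i ≤ N (i + 1) ∧ IsCyclic ((N (i + 1)).map (QuotientGroup.mk' (N i)))

-- The condition passes to quotients, so by induction on the order it suffices to find a nontrivial
-- cyclic normal subgroup. Everything rests on exhibiting five elements no two of which generate a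
-- nilpotent subgroup. Choosing one element from each Sylow `p`-subgroup makes these subgroups
-- normal for odd `p` (`subsingleton_sylow`); if only 2 divides the order, `G` is its own Sylow
-- 2-subgroup.
--
-- Let `Z` be the centre of a nontrivial normal Sylow `p`-subgroup. For `t` of order prime to `p`,
-- the conjugates of `t` under `Z` force `[t, Z]` to have at most 3 elements, so `t ^ 2` centralizes
-- `Z`. Hence `G / C(Z)` has exponent dividing 2 and is abelian, which makes `[t, Z]` normal, and it
-- is cyclic by its order (`exists_normal_isCyclic`). If `Z` is central in `G`, any cyclic subgroup
-- of it serves.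

universe u

/-! ### Inheritance and counting. -/

theorem SatisfiesPairCondition.subgroup {n : ℕ} {G : Type u} [Group G]
    (h : SatisfiesPairCondition NilpotentClass n G) (K : Subgroup G) :
    SatisfiesPairCondition NilpotentClass n K := by
  classical
  intro S hS
  obtain ⟨x, hx, y, hy, hxy, hn⟩ := h (S.map ⟨K.subtype, K.subtype_injective⟩) (by simpa using hS)
  simp only [Finset.mem_map, Function.Embedding.coeFn_mk] at hx hy
  obtain ⟨a, ha, rfl⟩ := hx
  obtain ⟨b, hb, rfl⟩ := hy
  refine ⟨a, ha, b, hb, fun h => hxy (by rw [h]), ?_⟩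
  have e : (Subgroup.closure ({a, b} : Set K)).map K.subtype =
      Subgroup.closure {K.subtype a, K.subtype b} := by
    rw [MonoidHom.map_closure, Set.image_pair]
  rw [← e] at hn
  exact (Group.isNilpotent_congr
    ((Subgroup.closure ({a, b} : Set K)).equivMapOfInjective K.subtype K.subtype_injective)).2 hn

theorem isNilpotent_map {G H : Type*} [Group G] [Group H] (f : G →* H) (K : Subgroup G)
    (hK : Group.IsNilpotent K) : Group.IsNilpotent (K.map f) :=
  Group.nilpotent_of_surjective (f.subgroupMap K) (f.subgroupMap_surjective K)

theorem SatisfiesPairCondition.of_surjective {n : ℕ} {G H : Type u} [Group G] [Group H]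
    (h : SatisfiesPairCondition NilpotentClass n G) (f : G →* H) (hf : Function.Surjective f) :
    SatisfiesPairCondition NilpotentClass n H := by
  classical
  intro S hS
  have hs : Function.RightInverse (Function.surjInv hf) f := Function.rightInverse_surjInv hf
  obtain ⟨x, hx, y, hy, hxy, hn⟩ :=
    h (S.map ⟨Function.surjInv hf, Function.injective_surjInv hf⟩) (by simpa using hS)
  simp only [Finset.mem_map, Function.Embedding.coeFn_mk] at hx hy
  obtain ⟨a, ha, rfl⟩ := hx
  obtain ⟨b, hb, rfl⟩ := hy
  refine ⟨a, ha, b, hb, fun h => hxy (by rw [h]), ?_⟩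
  have := isNilpotent_map f _ hn
  rwa [MonoidHom.map_closure, Set.image_pair, hs a, hs b] at this

/-- A family of distinct elements, no two of which generate a nilpotent subgroup, has at most `n`
members. -/
theorem SatisfiesPairCondition.card_le {n : ℕ} {G : Type u} [Group G]
    (h : SatisfiesPairCondition NilpotentClass n G) {ι : Type*} [Finite ι] (f : ι → G)
    (hf : Pairwise fun i j => f i ≠ f j ∧ ¬ Group.IsNilpotent (Subgroup.closure {f i, f j})) :
    Nat.card ι ≤ n := by
  classical
  by_contra! hn
  have := Fintype.ofFinite ι
  rw [Nat.card_eq_fintype_card] at hn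
  have inj : Function.Injective f := fun i j hij => by
    by_contra hne
    exact (hf hne).1 hij
  obtain ⟨T, -, hT⟩ := Finset.exists_subset_card_eq (s := (Finset.univ : Finset ι)) (n := n + 1)
    (by simpa using hn)
  obtain ⟨x, hx, y, hy, hxy, hnil⟩ := h (T.map ⟨f, inj⟩) (by simpa using hT)
  simp only [Finset.mem_map, Function.Embedding.coeFn_mk] at hx hy
  obtain ⟨a, -, rfl⟩ := hx
  obtain ⟨b, -, rfl⟩ := hy
  exact (hf fun h => hxy (by rw [h])).2 hnil

/-! ### Elements of nilpotent subgroups. -/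

/-- Modulo the centre `x` and `y` commute by induction, so their commutator is central and its order
divides both orders. -/
theorem commute_of_isNilpotent_of_coprime (H : Type*) [Group H] [Group.IsNilpotent H] :
    ∀ x y : H, (orderOf x).Coprime (orderOf y) → Commute x y := by
  refine Group.nilpotent_center_quotient_ind
    (P := fun H _ _ => ∀ x y : H, (orderOf x).Coprime (orderOf y) → Commute x y) H ?_ ?_
  · exact fun H _ _ x y _ => Subsingleton.elim _ _
  · intro H _ _ ih x y hxy
    have hq := ih (QuotientGroup.mk x) (QuotientGroup.mk y)
      (Nat.Coprime.of_dvd (orderOf_map_dvd (QuotientGroup.mk' _) x)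
        (orderOf_map_dvd (QuotientGroup.mk' _) y) hxy)
    obtain ⟨c, hc, hxc⟩ : ∃ c ∈ Subgroup.center H, x * y = y * x * c := by
      refine ⟨(y * x)⁻¹ * (x * y), ?_, by group⟩
      rw [← QuotientGroup.eq]
      exact hq.symm
    have hcc : ∀ g, c * g = g * c := fun g => (Subgroup.mem_center_iff.1 hc g).symm
    have h1 : SemiconjBy y (x * c) x := by
      change y * (x * c) = x * y
      rw [hxc, mul_assoc]
    have h2 : SemiconjBy x y (y * c) := by
      change x * y = y * c * x
      rw [hxc, mul_assoc, mul_assoc, hcc]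
    have e1 : c ^ orderOf x = 1 := by
      have := h1.pow_right (orderOf x)
      rw [(show Commute x c from (hcc x).symm).mul_pow, pow_orderOf_eq_one, one_mul] at this
      simpa [SemiconjBy] using this
    have e2 : c ^ orderOf y = 1 := by
      have := h2.pow_right (orderOf y)
      rw [(show Commute y c from (hcc y).symm).mul_pow, pow_orderOf_eq_one, one_mul] at this
      simpa [SemiconjBy] using this.symm
    have : orderOf c = 1 := Nat.eq_one_of_dvd_coprimes hxy (orderOf_dvd_of_pow_eq_one e1)
      (orderOf_dvd_of_pow_eq_one e2)
    rw [orderOf_eq_one_iff] at this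
    change x * y = y * x
    rw [hxc, this, mul_one]

/-- Elements of coprime orders of a group generated by two elements `x`, `y` commute when that
group is nilpotent. -/
theorem commute_of_mem_closure {G : Type*} [Group G] {S : Set G}
    (h : Group.IsNilpotent (Subgroup.closure S)) {a b : G}
    (ha : a ∈ Subgroup.closure S) (hb : b ∈ Subgroup.closure S)
    (hab : (orderOf a).Coprime (orderOf b)) : Commute a b := by
  have := commute_of_isNilpotent_of_coprime (Subgroup.closure S) ⟨a, ha⟩ ⟨b, hb⟩
    (by simpa [Subgroup.orderOf_mk] using hab)
  exact congrArg Subtype.val this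

theorem exists_sylow_mem_of_isNilpotent {G : Type*} [Group G] [Finite G] {p : ℕ} [Fact p.Prime]
    {x y : G} (h : Group.IsNilpotent (Subgroup.closure {x, y}))
    (hx : ∃ k, orderOf x = p ^ k) (hy : ∃ k, orderOf y = p ^ k) :
    ∃ P : Sylow p G, x ∈ P ∧ y ∈ P := by
  obtain ⟨S⟩ : Nonempty (Sylow p (Subgroup.closure ({x, y} : Set G))) := inferInstance
  have key : ∀ z : Subgroup.closure ({x, y} : Set G), (∃ k, orderOf (z : G) = p ^ k) → z ∈ S := by
    rintro z ⟨k, hk⟩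
    have hz : IsPGroup p (Subgroup.zpowers z) := by
      apply IsPGroup.of_card (n := k)
      rw [Nat.card_zpowers, ← hk, Subgroup.orderOf_coe]
    obtain ⟨Q, hQ⟩ := hz.exists_le_sylow
    have : Subsingleton (Sylow p (Subgroup.closure ({x, y} : Set G))) :=
      (Sylow.unique_of_normal S inferInstance).instSubsingleton
    rw [Subsingleton.elim S Q]
    exact hQ (Subgroup.mem_zpowers z)
  obtain ⟨P, hP⟩ := (S.2.map (Subgroup.subtype _)).exists_le_sylow
  exact ⟨P, hP ⟨⟨x, Subgroup.subset_closure (by simp)⟩, key _ hx, rfl⟩,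
    hP ⟨⟨y, Subgroup.subset_closure (by simp)⟩, key _ hy, rfl⟩⟩

/-! ### Derangements. -/

/-- By Burnside's count the average number of fixed points is 1, while the identity fixes more than
one. -/
theorem exists_forall_smul_ne {G X : Type*} [Group G] [Finite G] [MulAction G X] [Finite X]
    [MulAction.IsPretransitive G X] (hX : 1 < Nat.card X) : ∃ g : G, ∀ x : X, g • x ≠ x := by
  classical
  by_contra! h
  have := Fintype.ofFinite G
  have := Fintype.ofFinite X
  have hne : Nonempty X := (Nat.card_pos_iff.1 (by omega)).1
  have hb := MulAction.sum_card_fixedBy_eq_card_orbits_mul_card_group G X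
  have hone : Fintype.card (Quotient (MulAction.orbitRel G X)) = 1 := by
    rw [Fintype.card_eq_one_iff_nonempty_unique]
    have : Subsingleton (Quotient (MulAction.orbitRel G X)) :=
      MulAction.pretransitive_iff_subsingleton_quotient G X |>.1 inferInstance
    exact ⟨uniqueOfSubsingleton (Quotient.mk _ hne.some)⟩
  rw [hone, one_mul] at hb
  have hlt : ∑ _g : G, 1 < ∑ g : G, Fintype.card (MulAction.fixedBy X g) := by
    refine Finset.sum_lt_sum (fun g _ => ?_) ⟨1, Finset.mem_univ _, ?_⟩
    · obtain ⟨x, hx⟩ := h g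
      exact Fintype.card_pos_iff.2 ⟨⟨x, hx⟩⟩
    · rw [← Nat.card_eq_fintype_card, MulAction.fixedBy_one_eq_univ, Nat.card_univ]
      exact hX
  rw [hb] at hlt
  simp at hlt

/-- A derangement of four points is a 4-cycle or a double transposition. Cubing therefore removes
the 3-part of an order without creating fixed points. -/
theorem pow_three_apply_ne {X : Type*} (hX : Nat.card X = 4) (σ : Equiv.Perm X)
    (h : ∀ x, σ x ≠ x) : ∀ x, (σ ^ 3) x ≠ x := by
  have key : ∀ τ : Equiv.Perm (Fin 4), (∀ i, τ i ≠ i) → ∀ i, τ (τ (τ i)) ≠ i := by decide +kernel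
  have : Finite X := Nat.finite_of_card_ne_zero (by omega)
  let e : X ≃ Fin 4 := (Finite.equivFin X).trans (finCongr hX)
  intro x hx
  refine key (e.permCongr σ) (fun i hi => h (e.symm i) ?_) (e x) ?_
  · simpa [Equiv.permCongr_apply, ← Equiv.eq_symm_apply] using hi
  · simpa [Equiv.permCongr_apply, pow_succ] using hx

theorem exists_coprime_forall_smul_ne {G X : Type*} [Group G] [Finite G] [MulAction G X]
    [MulAction.IsPretransitive G X] (hX : Nat.card X = 4) :
    ∃ g : G, Nat.Coprime 3 (orderOf g) ∧ ∀ x : X, g • x ≠ x := by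
  have : Finite X := Nat.finite_of_card_ne_zero (by omega)
  obtain ⟨g, hg⟩ := exists_forall_smul_ne (G := G) (X := X) (by omega)
  have hpow : ∀ k x, (g ^ 3 ^ k) • x ≠ (x : X) := by
    intro k
    induction k with
    | zero => simpa using hg
    | succ k ih =>
      have := pow_three_apply_ne hX (MulAction.toPerm (g ^ 3 ^ k)) ih
      intro x hx
      refine this x ?_
      rw [pow_succ, pow_mul] at hx
      simpa [pow_succ, mul_smul] using hx
  obtain ⟨k, m, hm, hk⟩ := Nat.exists_eq_pow_mul_and_not_dvd (orderOf_pos g).ne' 3 (by norm_num)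
  refine ⟨g ^ 3 ^ k, ?_, hpow k⟩
  rw [orderOf_pow_of_dvd (by positivity) ⟨m, hk⟩, hk, Nat.mul_div_cancel_left _ (by positivity)]
  exact (Nat.Prime.coprime_iff_not_dvd Nat.prime_three).2 hm

/-! ### Normality of odd Sylow subgroups. -/

theorem orderOf_eq_pow_of_mem_sylow {G : Type*} [Group G] {p : ℕ} [Fact p.Prime] {P : Sylow p G}
    {x : G} (hx : x ∈ P) : ∃ k, orderOf x = p ^ k := by
  obtain ⟨k, hk⟩ := IsPGroup.iff_orderOf.1 P.2 ⟨x, hx⟩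
  exact ⟨k, by rwa [Subgroup.orderOf_mk] at hk⟩

/-- For odd `p`, the Sylow `p`-subgroup of a group satisfying `(𝒩, 4)` is unique as soon as the
pairwise intersections of Sylow `p`-subgroups lie in a subgroup containing none of them. -/
theorem subsingleton_sylow_of_inf_le {G : Type u} [Group G] [Finite G] {p : ℕ} [Fact p.Prime]
    (hp : p ≠ 2) (h : SatisfiesPairCondition NilpotentClass 4 G) (D : Subgroup G)
    (hD : ∀ R : Sylow p G, ¬ (R : Subgroup G) ≤ D)
    (hinf : ∀ R S : Sylow p G, R ≠ S → ((R : Subgroup G) ⊓ S : Subgroup G) ≤ D) :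
    Subsingleton (Sylow p G) := by
  have hx : ∀ R : Sylow p G, ∃ x ∈ R, x ∉ D := fun R => SetLike.not_le_iff_exists.1 (hD R)
  choose x hx hxD using hx
  have huniq : ∀ R S : Sylow p G, x R ∈ S → R = S := fun R S hS => by
    by_contra hne
    exact hxD R (hinf R S hne ⟨hx R, hS⟩)
  have hpair : Pairwise fun R S : Sylow p G =>
      x R ≠ x S ∧ ¬ Group.IsNilpotent (Subgroup.closure {x R, x S}) := by
    intro R S hne
    refine ⟨fun he => hne (huniq R S (he ▸ hx S)), fun hn => hne ?_⟩
    obtain ⟨T, hR, hS⟩ := exists_sylow_mem_of_isNilpotent hn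
      (orderOf_eq_pow_of_mem_sylow (hx R)) (orderOf_eq_pow_of_mem_sylow (hx S))
    rw [huniq R T hR, huniq S T hS]
  have hle := h.card_le x hpair
  rw [← Finite.card_le_one_iff_subsingleton]
  by_contra! hlt
  have hp3 : 3 ≤ p := by
    have := (Fact.out : p.Prime).two_le
    omega
  -- The number of Sylow subgroups minus one lies between 1 and 3 and is a multiple of `p ≥ 3`.
  have hdvd : p ∣ Nat.card (Sylow p G) - 1 :=
    (Nat.modEq_iff_dvd' hlt.le).1 (card_sylow_modEq_one p G).symm
  have hle' := Nat.le_of_dvd (by omega) hdvd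
  have hcard : Nat.card (Sylow p G) = 4 := by omega
  obtain rfl : p = 3 := by omega
  -- A 3'-element normalizing no Sylow 3-subgroup is the fifth element: commuting with `x R` would
  -- put `x R` in `y • R`, so `y • R = R`.
  obtain ⟨y, hy, hfix⟩ := exists_coprime_forall_smul_ne (G := G) hcard
  have hy' : ∀ R, ¬ Commute (x R) y := by
    intro R hc
    refine hfix R (huniq R (y • R) ?_).symm
    rw [← SetLike.mem_coe, Sylow.coe_smul]
    refine ⟨x R, hx R, ?_⟩
    simp [MulAut.conj_apply, ← hc.eq]
  have hyn : ∀ R, x R ≠ y ∧ ¬ Group.IsNilpotent (Subgroup.closure {x R, y}) := by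
    refine fun R => ⟨fun he => hy' R (he ▸ Commute.refl _), fun hn => hy' R ?_⟩
    refine commute_of_mem_closure hn (Subgroup.subset_closure (by simp))
      (Subgroup.subset_closure (by simp)) ?_
    obtain ⟨k, hk⟩ := orderOf_eq_pow_of_mem_sylow (hx R)
    rw [hk]
    exact hy.pow_left k
  have h5 := h.card_le (ι := Option (Sylow 3 G)) (fun o => o.elim y x) (by
    rintro (_ | R) (_ | S) hne
    · exact absurd rfl hne
    · exact ⟨(hyn S).1.symm, by rw [Set.pair_comm]; exact (hyn S).2⟩
    · exact hyn R
    · exact hpair fun he => hne (by rw [he]))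
  rw [Finite.card_option] at h5
  omega

/-- Let `D` be a maximal intersection of two distinct Sylow subgroups. In its normalizer, distinct
Sylow subgroups meet inside `D`, so the previous lemma applies there; since normalizers grow in
`p`-groups, uniqueness there contradicts the choice of `D`. -/
theorem subsingleton_sylow {G : Type u} [Group G] [Finite G] {p : ℕ} [Fact p.Prime]
    (hp : p ≠ 2) (h : SatisfiesPairCondition NilpotentClass 4 G) : Subsingleton (Sylow p G) := by
  by_contra hns
  rw [not_subsingleton_iff_nontrivial] at hns
  obtain ⟨P₀, Q₀, h₀⟩ := hns
  have : Nonempty {x : Sylow p G × Sylow p G // x.1 ≠ x.2} := ⟨⟨(P₀, Q₀), h₀⟩⟩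
  obtain ⟨⟨⟨P, Q⟩, hPQ⟩, hmax⟩ := Finite.exists_max
    fun x : {x : Sylow p G × Sylow p G // x.1 ≠ x.2} => Nat.card ((x.1.1 : Subgroup G) ⊓ x.1.2 : Subgroup G)
  simp only at hPQ hmax
  obtain ⟨D, hDdef⟩ : ∃ D : Subgroup G, D = (P : Subgroup G) ⊓ Q := ⟨_, rfl⟩
  replace hmax : ∀ R S : Sylow p G, D ≤ (R : Subgroup G) ⊓ S →
      R = S ∨ D = (R : Subgroup G) ⊓ S := fun R S hle => by
    by_cases hne : R = S
    · exact .inl hne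
    · refine .inr (Subgroup.eq_of_le_of_card_ge hle ?_)
      rw [hDdef]
      exact hmax ⟨(R, S), hne⟩
  have hDp : IsPGroup p D := P.2.to_le (hDdef ▸ inf_le_left)
  have hgrow : ∀ R : Sylow p G, D ≤ R → D ≠ R → 
      ¬ ((R : Subgroup G) ⊓ Subgroup.normalizer D : Subgroup G) ≤ D := by
    intro R hDR hne hle
    have := R.2.isNilpotent
    have hlt := Group.normalizerCondition_of_isNilpotent (D.subgroupOf R) (by
      rw [lt_top_iff_ne_top, Ne, Subgroup.subgroupOf_eq_top]
      exact fun h => hne (le_antisymm hDR h))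
    obtain ⟨⟨x, hxR⟩, hx, hxD⟩ := SetLike.exists_of_lt hlt
    refine hxD (hle ⟨hxR, ?_⟩)
    rw [Subgroup.mem_normalizer_iff] at hx
    refine Subgroup.mem_normalizer_iff.2 fun d => ?_
    by_cases hd : d ∈ (R : Subgroup G)
    · exact hx ⟨d, hd⟩
    · refine ⟨fun h => absurd (hDR h) hd, fun h => absurd ?_ hd⟩
      have := mul_mem (mul_mem (inv_mem hxR) (hDR h)) hxR
      simpa [mul_assoc] using this
  have hDP : D ≤ P := hDdef ▸ inf_le_left
  have hDQ : D ≤ Q := hDdef ▸ inf_le_right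
  have hPne : D ≠ P := fun he => hPQ (Sylow.ext (P.is_maximal' Q.2 (he ▸ hDQ)).symm)
  have hQne : D ≠ Q := fun he => hPQ (Sylow.ext (Q.is_maximal' P.2 (he ▸ hDP)))
  let K := Subgroup.normalizer (D : Set G)
  have hDK : D ≤ K := Subgroup.le_normalizer
  have hDK' : IsPGroup p (D.subgroupOf K) := hDp.comap_subtype
  have hnorm : (D.subgroupOf K).Normal := Subgroup.normal_in_normalizer
  have hext : ∀ R : Sylow p K, ∃ S : Sylow p G, (S : Subgroup G).subgroupOf K = R :=
    fun R => R.exists_comap_subtype_eq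
  have hsub : ∀ R : Sylow p K, D.subgroupOf K ≤ R := fun R => hDK'.le_sylow_of_normal R
  have hDle : ∀ (R : Sylow p K) (S : Sylow p G), (S : Subgroup G).subgroupOf K = R → D ≤ S := by
    intro R S hS d hd
    have : (⟨d, hDK hd⟩ : K) ∈ (S : Subgroup G).subgroupOf K := hS ▸ hsub R hd
    exact this
  have hsubs : Subsingleton (Sylow p K) := by
    refine subsingleton_sylow_of_inf_le hp (h.subgroup K) (D.subgroupOf K) ?_ ?_
    · intro R hR
      have hRP : (P : Subgroup G).subgroupOf K = R := R.is_maximal' P.2.comap_subtype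
        (hR.trans (Subgroup.comap_mono hDP))
      refine hgrow P hDP hPne ?_
      rintro x ⟨hxP, hxK⟩
      have : (⟨x, hxK⟩ : K) ∈ (P : Subgroup G).subgroupOf K := hxP
      exact hR (hRP ▸ this)
    · intro R S hne x hx
      obtain ⟨R', hR'⟩ := hext R
      obtain ⟨S', hS'⟩ := hext S
      rcases hmax R' S' (le_inf (hDle R R' hR') (hDle S S' hS')) with he | he
      · exact absurd (Sylow.ext (by rw [← hR', ← hS', he])) hne
      · rw [Subgroup.mem_subgroupOf, he]
        rw [← hR', ← hS'] at hx
        exact hx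
  obtain ⟨R⟩ : Nonempty (Sylow p K) := inferInstance
  obtain ⟨S, hS⟩ := hext R
  have hall : ∀ T : Sylow p G, D ≤ T → D ≠ T → T = S := by
    intro T hDT hne
    -- Otherwise `T ⊓ S = D`; but `T ⊓ K` lies in the unique Sylow subgroup `S ⊓ K` of `K`, hence in
    -- `D`.
    refine (hmax T S (le_inf hDT (hDle R S hS))).resolve_right fun he => hgrow T hDT hne ?_
    obtain ⟨R', hR'⟩ := (T.2.comap_subtype (K := K)).exists_le_sylow
    rintro x ⟨hxT, hxK⟩
    have : (⟨x, hxK⟩ : K) ∈ R := Subsingleton.elim R' R ▸ hR' hxT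
    rw [he]
    refine ⟨hxT, ?_⟩
    have h' : (⟨x, hxK⟩ : K) ∈ (S : Subgroup G).subgroupOf K := hS ▸ this
    exact h'
  exact hPQ ((hall P hDP hPne).trans (hall Q hDQ hQne).symm)

/-! ### Coprime action on an abelian normal subgroup. -/

/-- The subgroup `[t, Z]` for an abelian normal subgroup `Z`. -/
def commutatorRange {G : Type*} [Group G] (t : G) (Z : Subgroup G) [hn : Z.Normal]
    (hZ : ∀ a ∈ Z, ∀ b ∈ Z, a * b = b * a) : Subgroup G where
  carrier := {a | ∃ z ∈ Z, t * z * t⁻¹ * z⁻¹ = a}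
  one_mem' := ⟨1, Z.one_mem, by group⟩
  mul_mem' := by
    rintro _ _ ⟨z, hz, rfl⟩ ⟨w, hw, rfl⟩
    refine ⟨z * w, Z.mul_mem hz hw, ?_⟩
    have h := hZ _ (Z.inv_mem hz) _ (Z.mul_mem (hn.conj_mem w hw t) (Z.inv_mem hw))
    calc t * (z * w) * t⁻¹ * (z * w)⁻¹
        = t * z * t⁻¹ * (t * w * t⁻¹ * w⁻¹ * z⁻¹) := by group
      _ = _ := by rw [← h]; group
  inv_mem' := by
    rintro _ ⟨z, hz, rfl⟩
    refine ⟨z⁻¹, Z.inv_mem hz, ?_⟩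
    have h := hZ _ (Z.inv_mem (hn.conj_mem z hz t)) _ hz
    calc t * z⁻¹ * t⁻¹ * z⁻¹⁻¹ = (t * z * t⁻¹)⁻¹ * z := by group
      _ = _ := by rw [h]; group

section CommutatorRange

variable {G : Type u} [Group G] {Z : Subgroup G} [hn : Z.Normal]
  (hZ : ∀ a ∈ Z, ∀ b ∈ Z, a * b = b * a)

theorem commutatorRange_le (t : G) : commutatorRange t Z hZ ≤ Z := by
  rintro _ ⟨z, hz, rfl⟩
  exact Z.mul_mem (hn.conj_mem z hz t) (Z.inv_mem hz)

theorem conj_mem_commutatorRange {t a : G} (ha : a ∈ commutatorRange t Z hZ) :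
    t * a * t⁻¹ ∈ commutatorRange t Z hZ := by
  have h : t * a * t⁻¹ * a⁻¹ ∈ commutatorRange t Z hZ := ⟨a, commutatorRange_le hZ t ha, rfl⟩
  simpa using (commutatorRange t Z hZ).mul_mem h ha

theorem coprime_orderOf_of_mem {G : Type*} [Group G] {Z : Subgroup G} {p : ℕ} [Fact p.Prime]
    (hp : IsPGroup p Z) {t a : G} (ht : (orderOf t).Coprime p) (ha : a ∈ Z) :
    (orderOf t).Coprime (orderOf a) := by
  obtain ⟨k, hk⟩ := IsPGroup.iff_orderOf.1 hp ⟨a, ha⟩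
  rw [Subgroup.orderOf_mk] at hk
  rw [hk]
  exact ht.pow_right k

variable {p : ℕ} [Fact p.Prime]

/-- If `a = [t, z]` commutes with `t`, then `t ^ n * z = a ^ n * z * t ^ n`; taking `n = orderOf t`
gives `a ^ n = 1`. -/
theorem eq_one_of_commute_of_mem_commutatorRange (hp : IsPGroup p Z) {t a : G}
    (ht : (orderOf t).Coprime p) (ha : a ∈ commutatorRange t Z hZ) (hta : Commute t a) : a = 1 := by
  have haZ := commutatorRange_le hZ t ha
  have hcop := coprime_orderOf_of_mem hp ht haZ
  obtain ⟨z, hz, rfl⟩ := ha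
  generalize hadef : t * z * t⁻¹ * z⁻¹ = a at *
  have h1 : t * z = a * z * t := by rw [← hadef]; group
  have h : ∀ n : ℕ, t ^ n * z = a ^ n * z * t ^ n := by
    intro n
    induction n with
    | zero => simp
    | succ n ih =>
      calc t ^ (n + 1) * z = t * (t ^ n * z) := by rw [pow_succ', mul_assoc]
        _ = t * a ^ n * z * t ^ n := by rw [ih]; simp only [mul_assoc]
        _ = a ^ n * (t * z) * t ^ n := by rw [(hta.pow_right n).eq]; simp only [mul_assoc]
        _ = a ^ (n + 1) * z * t ^ (n + 1) := by
          rw [h1, pow_succ, pow_succ']; simp only [mul_assoc]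
  have h2 := h (orderOf t)
  rw [pow_orderOf_eq_one, one_mul, mul_one, right_eq_mul] at h2
  rw [← orderOf_eq_one_iff]
  exact Nat.eq_one_of_dvd_coprimes hcop (orderOf_dvd_of_pow_eq_one h2) dvd_rfl

/-- The elements `a t` with `a ∈ [t, Z]` are conjugate to `t`; together with a nontrivial element
of `[t, Z]` they pairwise generate non-nilpotent subgroups. -/
theorem card_commutatorRange_le (hp : IsPGroup p Z) [Finite G]
    (h : SatisfiesPairCondition NilpotentClass 4 G) {t : G}
    (ht : (orderOf t).Coprime p) : Nat.card (commutatorRange t Z hZ) ≤ 3 := by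
  obtain ⟨A, hA⟩ : ∃ A, A = commutatorRange t Z hZ := ⟨_, rfl⟩
  rw [← hA]
  by_cases hbot : A = ⊥
  · rw [hbot]
    simp
  obtain ⟨b, hb, hb1⟩ := A.bot_or_exists_ne_one.resolve_left hbot
  have hAZ : A ≤ Z := hA ▸ commutatorRange_le hZ t
  have hfix : ∀ a ∈ A, ∀ c ∈ A, Commute (a * t) c → c = 1 := by
    intro a ha c hc hcomm
    refine eq_one_of_commute_of_mem_commutatorRange hZ hp ht (hA ▸ hc) ?_
    have h1 : Commute a⁻¹ c := Commute.inv_left (hZ _ (hAZ ha) _ (hAZ hc))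
    simpa using h1.mul_left hcomm
  have hord : ∀ a ∈ A, ∀ c ∈ A, (orderOf (a * t)).Coprime (orderOf c) := by
    intro a ha c hc
    refine coprime_orderOf_of_mem hp ?_ (hAZ hc)
    have ha' := A.inv_mem ha
    rw [hA] at ha'
    obtain ⟨z, hz, hza⟩ := ha'
    have : a * t = MulAut.conj z t := by
      rw [← inv_inv a, ← hza, MulAut.conj_apply]
      group
    rw [this, MulEquiv.orderOf_eq]
    exact ht
  have hab : ∀ a : A, (a * t : G) ≠ b ∧ ¬ Group.IsNilpotent (Subgroup.closure {(a * t : G), b}) := by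
    refine fun a => ⟨fun he => hb1 (hfix a a.2 b hb (he ▸ Commute.refl _)), fun hnil => hb1 ?_⟩
    exact hfix a a.2 b hb (commute_of_mem_closure hnil (Subgroup.subset_closure (by simp))
      (Subgroup.subset_closure (by simp)) (hord a a.2 b hb))
  have h5 := h.card_le (ι := Option A) (fun o => o.elim b fun a => a * t) (by
    rintro (_ | a) (_ | c) hne
    · exact absurd rfl hne
    · exact ⟨(hab c).1.symm, by rw [Set.pair_comm]; exact (hab c).2⟩
    · exact hab a
    · have hac : (a : G) ≠ c := fun he => hne (by rw [Subtype.ext he])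
      refine ⟨fun he => hac (mul_right_cancel he), fun hnil => hac ?_⟩
      have hd : (c * a⁻¹ : G) ∈ A := A.mul_mem c.2 (A.inv_mem a.2)
      have h1 : (a * t : G) ∈ Subgroup.closure {(a * t : G), (c * t : G)} :=
        Subgroup.subset_closure (by simp)
      have h2 : (c * t : G) ∈ Subgroup.closure {(a * t : G), (c * t : G)} :=
        Subgroup.subset_closure (by simp)
      have h3 : (c * a⁻¹ : G) ∈ Subgroup.closure {(a * t : G), (c * t : G)} := by
        have := Subgroup.mul_mem _ h2 (Subgroup.inv_mem _ h1)
        simpa [mul_assoc] using this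
      have := hfix a a.2 _ hd (commute_of_mem_closure hnil h1 h3 (hord a a.2 _ hd))
      exact (mul_inv_eq_one.1 this).symm)
  rw [Finite.card_option] at h5
  omega

/-- Conjugation by `t` fixes no nontrivial element of `[t, Z]`, which has at most two of them, so `t
^ 2` centralizes `[t, Z]`. This contains `[t ^ 2, z]`, which is then trivial by coprimality. -/
theorem sq_commute_of_coprime {G : Type u} [Group G] {Z : Subgroup G} [hn : Z.Normal]
    (hZ : ∀ a ∈ Z, ∀ b ∈ Z, a * b = b * a) {p : ℕ} [Fact p.Prime] (hp : IsPGroup p Z) [Finite G]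
    (h : SatisfiesPairCondition NilpotentClass 4 G) {t : G} (ht : (orderOf t).Coprime p) {z : G} (hz : z ∈ Z) : Commute (t ^ 2) z := by
  obtain ⟨a, ha⟩ : ∃ a, t ^ 2 * z * (t ^ 2)⁻¹ * z⁻¹ = a := ⟨_, rfl⟩
  have ha2 : a ∈ commutatorRange (t ^ 2) Z hZ := ⟨z, hz, ha⟩
  have ha1 : a ∈ commutatorRange t Z hZ := by
    have := (commutatorRange t Z hZ).mul_mem
      ⟨t * z * t⁻¹, hn.conj_mem z hz t, rfl⟩ ⟨z, hz, rfl⟩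
    rw [← ha]
    convert this using 1
    rw [pow_two]
    group
  have hta : Commute (t ^ 2) a := by
    by_contra hnc
    have hne : a ≠ 1 := by
      rintro rfl
      exact hnc (Commute.one_right _)
    have hne2 : t * a * t⁻¹ ≠ a := fun he => hne
      (eq_one_of_commute_of_mem_commutatorRange hZ hp ht ha1 (mul_inv_eq_iff_eq_mul.1 he))
    have hb := conj_mem_commutatorRange hZ ha1
    have hc := conj_mem_commutatorRange hZ hb
    have hne3 : t * (t * a * t⁻¹) * t⁻¹ ≠ a := by
      intro he
      refine hnc ?_
      change t ^ 2 * a = a * t ^ 2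
      conv_rhs => rw [← he]
      rw [pow_two]
      group
    classical
    have hcard : ({1, a, t * a * t⁻¹, t * (t * a * t⁻¹) * t⁻¹} : Finset G).card = 4 := by
      rw [Finset.card_insert_of_notMem, Finset.card_insert_of_notMem,
        Finset.card_insert_of_notMem, Finset.card_singleton]
      · rw [Finset.mem_singleton]
        intro he
        exact hne2 (mul_left_cancel (mul_right_cancel he)).symm
      · simp only [Finset.mem_insert, Finset.mem_singleton, not_or]
        exact ⟨hne2.symm, hne3.symm⟩
      · simp only [Finset.mem_insert, Finset.mem_singleton, not_or]
        refine ⟨hne.symm, fun he => hne ?_, fun he => hne ?_⟩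
        · exact conj_eq_one_iff.1 he.symm
        · exact conj_eq_one_iff.1 (conj_eq_one_iff.1 he.symm)
    have hle := Set.ncard_le_ncard (s := (({1, a, t * a * t⁻¹, t * (t * a * t⁻¹) * t⁻¹} :
      Finset G) : Set G)) (t := commutatorRange t Z hZ) (by
        intro x hx
        simp only [Finset.coe_insert, Finset.coe_singleton, Set.mem_insert_iff,
          Set.mem_singleton_iff] at hx
        rcases hx with rfl | rfl | rfl | rfl
        · exact Subgroup.one_mem _
        · exact ha1
        · exact hb
        · exact hc)
    rw [Set.ncard_coe_finset, hcard] at hle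
    have h3 := card_commutatorRange_le hZ hp h ht
    have : Nat.card (commutatorRange t Z hZ) = (commutatorRange t Z hZ : Set G).ncard := rfl
    omega
  have hord : (orderOf (t ^ 2)).Coprime p := ht.coprime_dvd_left (orderOf_pow_dvd 2)
  have h1 := eq_one_of_commute_of_mem_commutatorRange hZ hp hord ha2 hta
  rw [h1] at ha
  exact mul_inv_eq_iff_eq_mul.1 (mul_inv_eq_one.1 ha)

end CommutatorRange

/-! ### A cyclic normal subgroup. -/

theorem isCyclic_of_natCard_le_three {A : Type*} [Group A] [Finite A] (h : Nat.card A ≤ 3) :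
    IsCyclic A := by
  have hpos : 0 < Nat.card A := Nat.card_pos
  by_cases h3 : Nat.card A = 3
  · exact isCyclic_of_prime_card (p := 3) h3
  · refine isCyclic_of_card_dvd_prime (p := 2) ?_
    interval_cases Nat.card A <;> simp_all

theorem exists_normal_isCyclic {G : Type u} [Group G] [Finite G] {p : ℕ} [Fact p.Prime]
    (h : SatisfiesPairCondition NilpotentClass 4 G) (P : Sylow p G) [hP : P.Normal]
    (hdvd : p ∣ Nat.card G) : ∃ A : Subgroup G, A.Normal ∧ IsCyclic A ∧ A ≠ ⊥ := by
  let Z : Subgroup G := (Subgroup.center P).map (P : Subgroup G).subtype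
  have hZn : Z.Normal := inferInstance
  have hZP : Z ≤ P := Subgroup.map_subtype_le _
  have hZcen : ∀ z ∈ Z, ∀ x ∈ P, x * z = z * x := by
    rintro _ ⟨z, hz, rfl⟩ x hx
    exact congrArg Subtype.val (Subgroup.mem_center_iff.1 hz ⟨x, hx⟩)
  have hZ : ∀ a ∈ Z, ∀ b ∈ Z, a * b = b * a := fun a ha b hb => hZcen b hb a (hZP ha)
  have hp : IsPGroup p Z := P.2.to_le hZP
  have hZbot : Z ≠ ⊥ := by
    have : Nontrivial P := (Subgroup.nontrivial_iff_ne_bot _).2 (P.ne_bot_of_dvd_card hdvd)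
    have := P.2.center_nontrivial
    intro hb
    rw [Subgroup.map_eq_bot_iff_of_injective _ (Subgroup.subtype_injective _)] at hb
    exact (Subgroup.nontrivial_iff_ne_bot _).1 this hb
  let C := Subgroup.centralizer (Z : Set G)
  have hCn : C.Normal := inferInstance
  have hPC : (P : Subgroup G) ≤ C := fun x hx => Subgroup.mem_centralizer_iff.2
    fun z hz => (hZcen z hz x hx).symm
  have hindex : ¬ p ∣ C.index := fun hd => P.not_dvd_index (hd.trans (Subgroup.index_dvd_of_le hPC))
  -- As `P ≤ C`, the order of `G / C` is prime to `p`, so membership in `C` can be tested on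
  -- `p'`-parts.
  have hroot : ∀ (g : G) (k : ℕ), g ^ p ^ k ∈ C → g ∈ C := by
    intro g k hg
    have h1 : (QuotientGroup.mk' C g) ^ p ^ k = 1 := by
      rw [← map_pow]
      exact (QuotientGroup.eq_one_iff _).2 hg
    have h2 : (QuotientGroup.mk' C g) ^ C.index = 1 := by
      rw [Subgroup.index, pow_card_eq_one']
    have h3 : (p ^ k).Coprime C.index :=
      (((Nat.Prime.coprime_iff_not_dvd Fact.out).2 hindex).pow_left k)
    have h4 : QuotientGroup.mk' C g = 1 := by
      rw [← orderOf_eq_one_iff]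
      exact Nat.eq_one_of_dvd_coprimes h3 (orderOf_dvd_of_pow_eq_one h1)
        (orderOf_dvd_of_pow_eq_one h2)
    exact (QuotientGroup.eq_one_iff g).1 h4
  have hpart : ∀ g : G, ∃ k, (orderOf (g ^ p ^ k)).Coprime p := by
    intro g
    have hp0 : 0 < p := (Fact.out : p.Prime).pos
    obtain ⟨k, m, hm, hk⟩ := Nat.exists_eq_pow_mul_and_not_dvd (orderOf_pos g).ne' p
      (Fact.out : p.Prime).ne_one
    refine ⟨k, ?_⟩
    rw [orderOf_pow_of_dvd (by positivity) ⟨m, hk⟩, hk, Nat.mul_div_cancel_left _ (by positivity)]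
    exact ((Nat.Prime.coprime_iff_not_dvd Fact.out).2 hm).symm
  have hsq : ∀ g : G, g ^ 2 ∈ C := by
    intro g
    obtain ⟨k, hk⟩ := hpart g
    refine hroot _ k ?_
    rw [← pow_mul, mul_comm, pow_mul]
    exact Subgroup.mem_centralizer_iff.2 fun z hz => (sq_commute_of_coprime hZ hp h hk hz).eq.symm
  by_cases hall : ∀ g : G, g ∈ C
  · obtain ⟨z, hz, hz1⟩ := Z.bot_or_exists_ne_one.resolve_left hZbot
    have hle : Subgroup.zpowers z ≤ Subgroup.center G := by
      rw [Subgroup.zpowers_le, Subgroup.mem_center_iff]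
      exact fun g => (Subgroup.mem_centralizer_iff.1 (hall g) z hz).symm
    refine ⟨Subgroup.zpowers z, ⟨fun x hx g => ?_⟩, inferInstance,
      by simpa using hz1⟩
    rwa [Subgroup.mem_center_iff.1 (hle hx) g, mul_inv_cancel_right]
  · push Not at hall
    obtain ⟨g, hg⟩ := hall
    obtain ⟨k, hk⟩ := hpart g
    have ht : g ^ p ^ k ∉ C := fun ht => hg (hroot g k ht)
    generalize g ^ p ^ k = t at hk ht
    refine ⟨commutatorRange t Z hZ, ⟨?_⟩,
      isCyclic_of_natCard_le_three (card_commutatorRange_le hZ hp h hk), fun hb => ht ?_⟩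
    · rintro _ ⟨z, hz, rfl⟩ s
      -- As `G / C` is abelian, `s * t * s⁻¹` acts on `Z` as `t` does, so conjugating `[t, z]` by
      -- `s` gives `[t, s * z * s⁻¹]`.
      have hst : t⁻¹ * (s * t * s⁻¹) ∈ C := by
        rw [← QuotientGroup.eq]
        have hsq' : ∀ x : G ⧸ C, x * x = 1 := by
          intro x
          obtain ⟨x, rfl⟩ := QuotientGroup.mk'_surjective C x
          rw [← map_mul, ← pow_two]
          exact (QuotientGroup.eq_one_iff _).2 (hsq x)
        have hinv : ∀ x : G ⧸ C, x⁻¹ = x := fun x => inv_eq_of_mul_eq_one_left (hsq' x)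
        have hcomm : (s : G ⧸ C) * t = t * s := by
          rw [← hinv (s * t), mul_inv_rev, hinv, hinv]
        rw [QuotientGroup.mk_mul, QuotientGroup.mk_mul, hcomm, QuotientGroup.mk_inv,
          mul_inv_cancel_right]
      refine ⟨s * z * s⁻¹, hZn.conj_mem z hz s, ?_⟩
      have hc := Subgroup.mem_centralizer_iff.1 hst _ (hZn.conj_mem z hz s)
      generalize hw : s * z * s⁻¹ = w at hc
      calc t * w * t⁻¹ * w⁻¹
          = t * (w * (t⁻¹ * (s * t * s⁻¹))) * (s * t * s⁻¹)⁻¹ * w⁻¹ := by group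
        _ = s * (t * z * t⁻¹ * z⁻¹) * s⁻¹ := by rw [hc, ← hw]; group
    · rw [Subgroup.mem_centralizer_iff]
      intro z hz
      have : t * z * t⁻¹ * z⁻¹ ∈ commutatorRange t Z hZ := ⟨z, hz, rfl⟩
      rw [hb, Subgroup.mem_bot, mul_inv_eq_one] at this
      exact (mul_inv_eq_iff_eq_mul.1 this).symm

/-! ### Lifting supersoluble series. -/

/-- An elementwise form lets cyclic factors be pulled back without comparing iterated quotients. -/
theorem isCyclic_map_mk'_iff {G : Type*} [Group G] (B N : Subgroup G) [N.Normal] :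
    IsCyclic (B.map (QuotientGroup.mk' N)) ↔ ∃ g ∈ B, ∀ b ∈ B, ∃ k : ℤ, (g ^ k)⁻¹ * b ∈ N := by
  constructor
  · rintro ⟨⟨_, g, hg, rfl⟩, h⟩
    refine ⟨g, hg, fun b hb => ?_⟩
    obtain ⟨k, hk⟩ := h ⟨_, b, hb, rfl⟩
    refine ⟨k, ?_⟩
    rw [← QuotientGroup.eq]
    exact congrArg Subtype.val hk
  · rintro ⟨g, hg, h⟩
    refine ⟨⟨_, g, hg, rfl⟩, ?_⟩
    rintro ⟨_, b, hb, rfl⟩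
    obtain ⟨k, hk⟩ := h b hb
    refine ⟨k, Subtype.ext ?_⟩
    rw [← QuotientGroup.eq] at hk
    exact hk

theorem IsSupersoluble.of_subsingleton {G : Type*} [Group G] [Subsingleton G] :
    IsSupersoluble G :=
  ⟨0, fun _ => ⊥, fun _ => inferInstance, rfl, Subsingleton.elim _ _, fun i hi => by omega⟩

theorem IsSupersoluble.of_quotient {G : Type*} [Group G] (A : Subgroup G) [hA : A.Normal]
    [IsCyclic A] (h : IsSupersoluble (G ⧸ A)) : IsSupersoluble G := by
  obtain ⟨r, N, hN, h0, hr, hs⟩ := h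
  have hnorm : ∀ i, (Nat.casesOn i ⊥ fun j => (N j).comap (QuotientGroup.mk' A) :
      Subgroup G).Normal := by
    intro i
    cases i with
    | zero => exact (inferInstance : (⊥ : Subgroup G).Normal)
    | succ j => exact (hN j).comap _
  refine ⟨r + 1, fun i => Nat.casesOn i ⊥ fun j => (N j).comap (QuotientGroup.mk' A), hnorm, rfl,
    ?_, ?_⟩
  · change (N r).comap _ = ⊤
    rw [hr, Subgroup.comap_top]
  · intro i hi
    cases i with
    | zero =>
      refine ⟨bot_le, ?_⟩
      change IsCyclic (((N 0).comap (QuotientGroup.mk' A)).map (QuotientGroup.mk' ⊥))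
      rw [h0, MonoidHom.comap_bot, QuotientGroup.ker_mk']
      exact isCyclic_of_surjective _ ((QuotientGroup.mk' ⊥).subgroupMap_surjective A)
    | succ j =>
      obtain ⟨hle, hc⟩ := hs j (by omega)
      refine ⟨Subgroup.comap_mono hle, ?_⟩
      have := hnorm (j + 1)
      rw [isCyclic_map_mk'_iff] at hc
      obtain ⟨g, hg, h⟩ := hc
      obtain ⟨g, rfl⟩ := QuotientGroup.mk'_surjective A g
      refine (isCyclic_map_mk'_iff _ _).2 ⟨g, hg, fun b hb => ?_⟩
      obtain ⟨k, hk⟩ := h (QuotientGroup.mk' A b) hb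
      exact ⟨k, by simpa using hk⟩

/-! ### The alternating group and the final induction. -/

theorem satisfiesPairCondition_alternatingGroup_four :
    SatisfiesPairCondition NilpotentClass 5 (alternatingGroup (Fin 4)) := by
  intro S hS
  -- Five colours for six elements: `none` for the Klein four-group, the fixed point for a 3-cycle.
  -- Each colour class lies in an abelian subgroup.
  let c : alternatingGroup (Fin 4) → Option (Fin 4) := fun σ =>
    if σ * σ = 1 then none else Fin.find? fun i => σ.1 i = i
  have hc : ∀ x y : alternatingGroup (Fin 4), c x = c y → x * y = y * x := by decide +kernel
  obtain ⟨x, hx, y, hy, hxy, he⟩ := Finset.exists_ne_map_eq_of_card_lt_of_maps_to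
    (s := S) (t := (Finset.univ : Finset (Option (Fin 4)))) (f := c) (by simp [hS])
    (fun _ _ => Finset.mem_coe.2 (Finset.mem_univ _))
  refine ⟨x, hx, y, hy, hxy, ?_⟩
  have hcomm := hc x y he
  have := Subgroup.isMulCommutative_closure (k := ({x, y} : Set (alternatingGroup (Fin 4)))) (by
    rintro a (rfl | rfl) b (rfl | rfl) <;> first | rfl | exact hcomm | exact hcomm.symm)
  let _ : CommGroup (Subgroup.closure ({x, y} : Set (alternatingGroup (Fin 4)))) :=
    { mul_comm := this.is_comm.comm }
  exact CommGroup.isNilpotent (G := Subgroup.closure ({x, y} : Set (alternatingGroup (Fin 4))))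

theorem isSupersoluble_of_satisfiesPairCondition_four (G : Type u) [Group G] [Finite G]
    (h : SatisfiesPairCondition NilpotentClass 4 G) : IsSupersoluble G := by
  induction hn : Nat.card G using Nat.strong_induction_on generalizing G with
  | _ n ih =>
    cases subsingleton_or_nontrivial G with
    | inl _ => exact IsSupersoluble.of_subsingleton
    | inr _ =>
      obtain ⟨A, hAn, hAc, hA⟩ : ∃ A : Subgroup G, A.Normal ∧ IsCyclic A ∧ A ≠ ⊥ := by
        by_cases hodd : ∃ p, p.Prime ∧ p ∣ Nat.card G ∧ p ≠ 2
        · obtain ⟨p, hp, hdvd, hp2⟩ := hodd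
          have : Fact p.Prime := ⟨hp⟩
          have := subsingleton_sylow (p := p) hp2 h
          obtain ⟨P⟩ : Nonempty (Sylow p G) := inferInstance
          have := P.normal_of_subsingleton
          exact exists_normal_isCyclic h P hdvd
        · push Not at hodd
          have hcard := Nat.eq_prime_pow_of_unique_prime_dvd Nat.card_pos.ne'
            fun {d} hd hdvd => hodd d hd hdvd
          have hpg : IsPGroup 2 G := IsPGroup.of_card hcard
          obtain ⟨P⟩ : Nonempty (Sylow 2 G) := inferInstance
          have htop : (P : Subgroup G) = ⊤ :=
            (P.is_maximal' (hpg.to_subgroup ⊤) le_top).symm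
          have : P.Normal := by
            rw [htop]
            infer_instance
          obtain ⟨p, hp, hdvd⟩ := Nat.exists_prime_and_dvd (Finite.one_lt_card (α := G)).ne'
          exact exists_normal_isCyclic h P (hodd p hp hdvd ▸ hdvd)
      have hlt : Nat.card (G ⧸ A) < n := by
        rw [← hn, A.card_eq_card_quotient_mul_card_subgroup]
        exact lt_mul_of_one_lt_right Nat.card_pos (A.one_lt_card_iff_ne_bot.2 hA)
      exact IsSupersoluble.of_quotient A
        (ih _ hlt _ (h.of_surjective _ (QuotientGroup.mk'_surjective A)) rfl)

theorem corollary2p3 :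
    (∀ (G : Type*) [Group G] [Finite G],
      SatisfiesPairCondition NilpotentClass 4 G → IsSupersoluble G) ∧
    SatisfiesPairCondition NilpotentClass 5 (alternatingGroup (Fin 4)) := by
  exact ⟨fun G _ _ h => isSupersoluble_of_satisfiesPairCondition_four G h,
    satisfiesPairCondition_alternatingGroup_four⟩
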